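/- Conventions. Manifolds are smooth (real, finite-dimensional, without boundary, Hausdorff). An almost complex structure on $M$ is a smooth field $J$ of endomorphisms of the tangent spaces with $J^2=-\mathrm{Id}$, and $\nabla$ denotes a connection on $TM$ with torsion $T(X,Y)=\nabla_XY-\nabla_YX-[X,Y]$. A smooth map $f:N\to N'$ is $(A,A')$-holomorphic, for fields $A,A'$ of endomorphisms of the tangent spaces of $N,N'$, if $A'(f(x))\circ d_xf=d_xf\circ A(x)$ for every $x\in N$. Let $\pi:T^*M\to M$ be the projection. The connection induced by $\nabla$ on $T^*M$ is $(\nabla_Xs)(Y)=X.s(Y)-s(\nabla_XY)$. For $\xi\in T^*M$ with $\pi(\xi)=x$ put $$H^\nabla_\xi=\{d_xs(X)\;:\;X\in T_xM,\ s\in\Gamma(T^*M),\ s(x)=\xi,\ \nabla_Xs=0\}\subseteq T_\xi T^*M .$$ Then $d_\xi\pi$ maps $H^\nabla_\xi$ isomorphically onto $T_xM$, and $T_\xi T^*M=H^\nabla_\xi\oplus T^*_xM$, where $T^*_xM$ is identified with the vertical subspace. The generalized horizontal lift $J^{G,\nabla}$ of $J$ is the field of endomorphisms of $T(T^*M)$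 that at $\xi$ equals $J\oplus{}^tJ$ in this decomposition: it maps $Y\in H^\nabla_\xi$ to the element of $H^\nabla_\xi$ with projection $J(x)\,d_\xi\pi(Y)$, and it maps $\eta\in T^*_xM$ to $\eta\circ J(x)$. Define also the tensors $(\nabla J)(X,Y)=\nabla_X(JY)-J\nabla_XY$ and $$S(X,Y)=-(\nabla J)(X,Y)+(\nabla J)(Y,X)+T(JX,Y)-J\,T(X,Y).$$ Theorem. 1. Let $J$ be an almost complex structure and $\nabla$ a connection on $M$. The projection $\pi:T^*M\to M$ is $(J^{G,\nabla},J)$-holomorphic. 2. With $M,J,\nabla$ as in 1, the zero section $M\to T^*M$ is $(J,J^{G,\nabla})$-holomorphic. 3. For $i=1,2$ let $M_i$ be a manifold with an almost complex structure $J_i$ and a connection $\nabla_i$, and let $S_i$ be the tensor $S$ of $(J_i,\nabla_i)$. Let $f:M_1\to M_2$ be a diffeomorphism, with lift $\tilde f:T^*M_1\to T^*M_2$ given by $\tilde f(\xi)=\xi\circ(d_xf)^{-1}\in T^*_{f(x)}M_2$ for $\xi\in T^*_xM_1$. Then $\tilde f$ is $(J_1^{G,\nabla_1},J_2^{G,\nabla_2})$-holomorphic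 if and only if $f$ is $(J_1,J_2)$-holomorphic and $f_*S_1=S_2$, where $(f_*S_1)_{f(x)}(X,Y)=d_xf\big(S_1((d_xf)^{-1}X,(d_xf)^{-1}Y)\big)$. -/

import Mathlib

open Bundle Manifold
open scoped ContDiff Manifold Topology

noncomputable section

namespace CotangentLift

/-! ### The cotangent bundle and its splitting by a connection -/

/-- The cotangent space `T*_x M` of an `n`-dimensional manifold. -/
abbrev CotangentSpace (n : ℕ) {M : Type*} [TopologicalSpace M]
    [ChartedSpace (EuclideanSpace ℝ (Fin n)) M] (x : M) : Type :=
  TangentSpace (𝓡 n) x →L[ℝ] ℝ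

/-- The total space `T*M`, with the topology and smooth structure of a vector bundle that Mathlib
puts on the bundle `Hom(TM, ℝ)`. -/
abbrev CotangentBundle (n : ℕ) (M : Type*) [TopologicalSpace M]
    [ChartedSpace (EuclideanSpace ℝ (Fin n)) M] : Type _ :=
  TotalSpace (EuclideanSpace ℝ (Fin n) →L[ℝ] ℝ) (fun x : M => CotangentSpace n x)

/-- The model with corners of `T*M`. -/
abbrev cotangentModel (n : ℕ) :=
  (𝓡 n).prod 𝓘(ℝ, EuclideanSpace ℝ (Fin n) →L[ℝ] ℝ)

/-- A connection on the tangent bundle of `M`; `∇ Y x X` is `∇_X Y` at `x`. -/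
abbrev AffineConnection (n : ℕ) (M : Type*) [TopologicalSpace M]
    [ChartedSpace (EuclideanSpace ℝ (Fin n)) M] [IsManifold (𝓡 n) ∞ M] : Type _ :=
  CovariantDerivative (𝓡 n) (EuclideanSpace ℝ (Fin n)) (TangentSpace (𝓡 n) : M → Type _)

/-- Linear algebra: an endomorphism can be prescribed on the two factors of a splitting. -/
theorem existsUnique_product {T X C : Type*} [NormedAddCommGroup T] [NormedSpace ℝ T]
    [FiniteDimensional ℝ T] [NormedAddCommGroup X] [NormedSpace ℝ X] [NormedAddCommGroup C]
    [NormedSpace ℝ C] (p : T →L[ℝ] X) (v : T →L[ℝ] C) (i : C →L[ℝ] T) (H : Set T)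
    (J : X →L[ℝ] X) (J' : C →L[ℝ] C) (hpi : ∀ η, p (i η) = 0) (hvi : ∀ η, v (i η) = η)
    (hH : ∀ V, V ∈ H ↔ v V = 0) (hs : ∀ x, ∃ V ∈ H, p V = x)
    (hi : ∀ V, p V = 0 → v V = 0 → V = 0) :
    ∃! A : T →L[ℝ] T, (∀ V ∈ H, A V ∈ H) ∧ (∀ V ∈ H, p (A V) = J (p V)) ∧
      ∀ η, A (i η) = i (J' η) := by
  choose h hh hp using hs
  have hvh : ∀ x, v (h x) = 0 := fun x => (hH _).1 (hh x)
  have hext : ∀ V W, p V = p W → v V = v W → V = W := fun V W h1 h2 =>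
    sub_eq_zero.1 (hi _ (by rw [map_sub, h1, sub_self]) (by rw [map_sub, h2, sub_self]))
  let T₀ : T →ₗ[ℝ] T :=
    { toFun := fun V => h (J (p V)) + i (J' (v V))
      map_add' := fun V W => hext _ _ (by simp [hp, hpi]) (by simp [hvh, hvi])
      map_smul' := fun c V => hext _ _ (by simp [hp, hpi]) (by simp [hvh, hvi]) }
  refine ⟨LinearMap.toContinuousLinearMap T₀, ⟨fun V hV => ?_, fun V hV => ?_, fun η => ?_⟩, ?_⟩
  · rw [hH] at hV ⊢
    simp [T₀, hV, hvh]
  · simp [T₀, hp, hpi]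
  · exact hext _ _ (by simp [T₀, hp, hpi]) (by simp [T₀, hvh, hvi])
  · rintro B ⟨h1, h2, h3⟩
    refine ContinuousLinearMap.ext fun V => ?_
    have hV : V = h (p V) + i (v V) := hext _ _ (by simp [hp, hpi]) (by simp [hvh, hvi])
    have hB : B V = B (h (p V)) + i (J' (v V)) := by
      conv_lhs => rw [hV]
      rw [map_add, h3]
    refine hext _ _ ?_ ?_
    · rw [hB, map_add, h2 _ (hh _), hp]
      simp [T₀, hp, hpi]
    · rw [hB, map_add, (hH _).1 (h1 _ (hh _))]
      simp [T₀, hvh, hvi]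

section Defs

variable {n : ℕ} {M : Type*} [TopologicalSpace M]
    [ChartedSpace (EuclideanSpace ℝ (Fin n)) M] [IsManifold (𝓡 n) ∞ M]

/-- A vector field is smooth, i.e. is an element of `Γ(TM)`. -/
def SmoothField (Z : Π x : M, TangentSpace (𝓡 n) x) : Prop :=
  ContMDiff (𝓡 n) ((𝓡 n).prod 𝓘(ℝ, EuclideanSpace ℝ (Fin n))) ∞
    (fun x => TotalSpace.mk' (EuclideanSpace ℝ (Fin n)) x (Z x))

/-- The map `M → T*M` given by a one-form. -/
def sectionMap (s : Π x : M, CotangentSpace n x) (x : M) : CotangentBundle n M := ⟨x, s x⟩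

/-- The one-form is smooth, i.e. is an element of `Γ(T*M)`. -/
def SmoothForm (s : Π x : M, CotangentSpace n x) : Prop :=
  ContMDiff (𝓡 n) (cotangentModel n) ∞ (sectionMap s)

/-- The number `(∇_X s)(Z) = X.s(Z) - s(∇_X Z)` at `x`. -/
def dualDerivative (cov : AffineConnection n M) (s : Π x : M, CotangentSpace n x)
    (Z : Π x : M, TangentSpace (𝓡 n) x) (x : M) (X : TangentSpace (𝓡 n) x) : ℝ :=
  mvfderiv (𝓡 n) (fun y => s y (Z y)) x X - s x (cov Z x X)

/-- The horizontal space
`H_ξ = {d_x s (X) | X ∈ T_x M, s ∈ Γ(T*M), s(x) = ξ, ∇_X s = 0} ⊆ T_ξ T*M`, where `x = π(ξ)`. -/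
def horizontalSpace (cov : AffineConnection n M) (ξ : CotangentBundle n M) :
    Set (TangentSpace (cotangentModel n) ξ) :=
  {V | ∃ (s : Π x : M, CotangentSpace n x) (X : TangentSpace (𝓡 n) ξ.proj),
    SmoothForm s ∧ s ξ.proj = ξ.2 ∧
    (∀ Z : Π x : M, TangentSpace (𝓡 n) x, SmoothField Z → dualDerivative cov s Z ξ.proj X = 0) ∧
    tangentMap (𝓡 n) (cotangentModel n) (sectionMap s) ⟨ξ.proj, X⟩ = ⟨ξ, V⟩}

/-- The differential `d_ξ π : T_ξ T*M → T_x M`. -/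
def projDeriv (ξ : CotangentBundle n M) :
    TangentSpace (cotangentModel n) ξ →L[ℝ] TangentSpace (𝓡 n) ξ.proj :=
  mfderiv (cotangentModel n) (𝓡 n)
    (TotalSpace.proj : CotangentBundle n M → M) ξ

/-- The identification of `T*_x M` with the vertical subspace of `T_ξ T*M`: the differential at `ξ`
of the inclusion of the fibre through `ξ`. -/
def verticalLift (ξ : CotangentBundle n M) :
    CotangentSpace n ξ.proj →L[ℝ] TangentSpace (cotangentModel n) ξ :=
  mfderiv 𝓘(ℝ, EuclideanSpace ℝ (Fin n) →L[ℝ] ℝ) (cotangentModel n)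
    (fun p : EuclideanSpace ℝ (Fin n) →L[ℝ] ℝ => (⟨ξ.proj, p⟩ : CotangentBundle n M)) ξ.2

/-- The function `η ↦ η(Z)` on `T*M`. -/
def pairing (Z : Π x : M, TangentSpace (𝓡 n) x) (ξ : CotangentBundle n M) : ℝ :=
  ξ.2 (Z ξ.proj)

theorem pairing_mdiff {Z : Π x : M, TangentSpace (𝓡 n) x} {ξ : CotangentBundle n M}
    (hZ : MDifferentiableAt (𝓡 n) ((𝓡 n).prod 𝓘(ℝ, EuclideanSpace ℝ (Fin n)))
      (fun x => TotalSpace.mk' (EuclideanSpace ℝ (Fin n)) x (Z x)) ξ.proj) :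
    MDifferentiableAt (cotangentModel n) 𝓘(ℝ, ℝ) (pairing Z) ξ := by
  have h1 : MDifferentiableAt (cotangentModel n) ((𝓡 n).prod 𝓘(ℝ, ℝ))
      (fun ξ : CotangentBundle n M => TotalSpace.mk' ℝ (E := Bundle.Trivial M ℝ) ξ.proj
        (ξ.2 (Z ξ.proj))) ξ := by
    apply MDifferentiableAt.clm_bundle_apply (IB := 𝓡 n) (F₁ := EuclideanSpace ℝ (Fin n)) (F₂ := ℝ)
      (E₁ := (TangentSpace (𝓡 n) : M → Type _)) (E₂ := Bundle.Trivial M ℝ)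
      (b := fun ξ : CotangentBundle n M => ξ.proj) (ϕ := fun ξ => ξ.2)
      (v := fun ξ => Z ξ.proj)
    · exact mdifferentiableAt_id
    · exact MDifferentiableAt.comp (I' := 𝓡 n) ξ hZ
        (mdifferentiableAt_proj (E := fun x : M => CotangentSpace n x))
  rw [mdifferentiableAt_totalSpace] at h1
  exact h1.2

theorem fibre_mdiff (x : M) (p : EuclideanSpace ℝ (Fin n) →L[ℝ] ℝ) :
    MDifferentiableAt 𝓘(ℝ, EuclideanSpace ℝ (Fin n) →L[ℝ] ℝ) (cotangentModel n)
      (fun p : EuclideanSpace ℝ (Fin n) →L[ℝ] ℝ => (⟨x, p⟩ : CotangentBundle n M)) p := by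
  rw [mdifferentiableAt_totalSpace]
  refine ⟨mdifferentiableAt_const, ?_⟩
  let t := trivializationAt (EuclideanSpace ℝ (Fin n) →L[ℝ] ℝ)
    (fun x : M => CotangentSpace n x) x
  let L : (EuclideanSpace ℝ (Fin n) →L[ℝ] ℝ) →L[ℝ] (EuclideanSpace ℝ (Fin n) →L[ℝ] ℝ) :=
    (t.continuousLinearMapAt ℝ x : CotangentSpace n x →L[ℝ] _)
  have hL : ∀ q : EuclideanSpace ℝ (Fin n) →L[ℝ] ℝ,
      (t (⟨x, q⟩ : CotangentBundle n M)).2 = L q := by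
    intro q
    exact (congrFun (t.coe_linearMapAt_of_mem (R := ℝ)
      (FiberBundle.mem_baseSet_trivializationAt' x)) q).symm
  have h := L.differentiable.mdifferentiable p
  exact h.congr_of_eventuallyEq (Filter.Eventually.of_forall hL)

theorem exists_smooth {F : Type*} [NormedAddCommGroup F] [NormedSpace ℝ F] {V : M → Type*}
    [TopologicalSpace (TotalSpace F V)] [∀ x, AddCommGroup (V x)] [∀ x, Module ℝ (V x)]
    [∀ x, TopologicalSpace (V x)] [FiberBundle F V] [VectorBundle ℝ F V]
    [ContMDiffVectorBundle ∞ F V (𝓡 n)] [T2Space M] {x : M} (v : V x) :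
    ∃ s : Π x, V x, ContMDiff (𝓡 n) ((𝓡 n).prod 𝓘(ℝ, F)) ∞
      (fun y => TotalSpace.mk' F y (s y)) ∧ s x = v := by
  obtain ⟨u, hu, hs⟩ := FiberBundle.exists_contMDiffOn_extend (k := ∞) (𝓡 n) F v
  have hu' : interior u ∈ 𝓝 x := interior_mem_nhds.2 hu
  obtain ⟨ψ, -, hψ⟩ := (SmoothBumpFunction.nhds_basis_tsupport (I := 𝓡 n) x).mem_iff.1 hu'
  refine ⟨(ψ : M → ℝ) • FiberBundle.extend F v, ?_, ?_⟩
  · exact ContMDiffOn.smul_section_of_tsupport ψ.contMDiff.contMDiffOn isOpen_interior hψ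
      (hs.mono interior_subset)
  · simp

theorem exists_smoothField [T2Space M] {x : M} (z : TangentSpace (𝓡 n) x) :
    ∃ Z : Π x : M, TangentSpace (𝓡 n) x, SmoothField Z ∧ Z x = z :=
  exists_smooth (n := n) (F := EuclideanSpace ℝ (Fin n))
    (V := (TangentSpace (𝓡 n) : M → Type _)) z

theorem exists_smoothForm [T2Space M] {x : M} (p : CotangentSpace n x) :
    ∃ s : Π x : M, CotangentSpace n x, SmoothForm s ∧ s x = p :=
  exists_smooth (n := n) (F := EuclideanSpace ℝ (Fin n) →L[ℝ] ℝ)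
    (V := fun x : M => CotangentSpace n x) p

theorem exists_function [T2Space M] {x : M} {X : TangentSpace (𝓡 n) x} (hX : X ≠ 0) :
    ∃ g : M → ℝ, ContMDiff (𝓡 n) 𝓘(ℝ, ℝ) ∞ g ∧ g x = 0 ∧ mvfderiv (𝓡 n) g x X = 1 := by
  obtain ⟨ψ⟩ : Nonempty (SmoothBumpFunction (𝓡 n) x) := inferInstance
  let h : M → EuclideanSpace ℝ (Fin n) := fun y => ψ y • extChartAt (𝓡 n) x y
  have hh : ContMDiff (𝓡 n) 𝓘(ℝ, EuclideanSpace ℝ (Fin n)) ∞ h :=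
    ψ.contMDiff_smul (contMDiffOn_extChartAt (n := ∞))
  have he : h =ᶠ[𝓝 x] extChartAt (𝓡 n) x := by
    filter_upwards [ψ.eventuallyEq_one] with y hy
    simp [h, hy]
  have hd : mfderiv (𝓡 n) 𝓘(ℝ, EuclideanSpace ℝ (Fin n)) h x X ≠ 0 := by
    rw [he.mfderiv_eq]
    intro h0
    obtain ⟨e, he⟩ := isInvertible_mfderiv_extChartAt (I := 𝓡 n) (mem_extChartAt_source (I := 𝓡 n) x)
    rw [← he] at h0
    exact hX (e.map_eq_zero_iff.1 h0)
  let w : EuclideanSpace ℝ (Fin n) := mfderiv (𝓡 n) 𝓘(ℝ, EuclideanSpace ℝ (Fin n)) h x X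
  have hw : w ≠ 0 := hd
  obtain ⟨φ, hφ⟩ : ∃ φ : EuclideanSpace ℝ (Fin n) →L[ℝ] ℝ, φ w = 1 :=
    ⟨(‖w‖ ^ 2)⁻¹ • innerSL ℝ w, by
      have : ‖w‖ ^ 2 ≠ 0 := by positivity
      simp [this]⟩
  refine ⟨fun y => φ (h y) - φ (h x), ?_, by simp, ?_⟩
  · exact (φ.contMDiff.comp hh).sub contMDiff_const
  · have h1 : MDifferentiableAt (𝓡 n) 𝓘(ℝ, EuclideanSpace ℝ (Fin n)) h x :=
      (hh x).mdifferentiableAt (by simp)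
    have h2 : HasMFDerivAt (𝓡 n) 𝓘(ℝ, ℝ) (fun y => φ (h y)) x
        (φ ∘L mfderiv (𝓡 n) 𝓘(ℝ, EuclideanSpace ℝ (Fin n)) h x) :=
      HasMFDerivAt.comp x φ.hasMFDerivAt h1.hasMFDerivAt
    have h3 := h2.sub (hasMFDerivAt_const (I := 𝓡 n) (I' := 𝓘(ℝ, ℝ)) (φ (h x)) x)
    have h4 : mfderiv (𝓡 n) 𝓘(ℝ, ℝ) (fun y => φ (h y) - φ (h x)) x = _ := h3.mfderiv
    simp only [mvfderiv]
    rw [h4]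
    have h5 : (φ ∘L mfderiv (𝓡 n) 𝓘(ℝ, EuclideanSpace ℝ (Fin n)) h x) X = 1 := hφ
    have h6 : (φ ∘L mfderiv (𝓡 n) 𝓘(ℝ, EuclideanSpace ℝ (Fin n)) h x) - 0 =
      (φ ∘L mfderiv (𝓡 n) 𝓘(ℝ, EuclideanSpace ℝ (Fin n)) h x) := sub_zero _
    exact (DFunLike.congr_fun h6 X).trans h5

/-- The tensorial expression `Z ↦ d(pairing Z) - ξ(∇ Z) ∘ dπ` of the vertical projection. -/
theorem connector_tensorial (cov : AffineConnection n M) (ξ : CotangentBundle n M) :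
    TensorialAt (𝓡 n) (EuclideanSpace ℝ (Fin n))
      (fun Z : Π x : M, TangentSpace (𝓡 n) x =>
        mvfderiv (cotangentModel n) (pairing Z) ξ - (ξ.2 ∘L cov Z ξ.proj) ∘L projDeriv ξ)
      ξ.proj where
  smul {f σ} hf hσ := by
    have hp : MDifferentiableAt (cotangentModel n) (𝓡 n)
      (TotalSpace.proj : CotangentBundle n M → M) ξ :=
      mdifferentiableAt_proj (E := fun x : M => CotangentSpace n x)
    have h1 : pairing (f • σ) = fun η : CotangentBundle n M => f η.proj • pairing σ η := by
      ext η; simp [pairing]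
    have h2 : mvfderiv (cotangentModel n) (fun η : CotangentBundle n M => f η.proj) ξ
        = mvfderiv (𝓡 n) f ξ.proj ∘L projDeriv ξ := by
      simp only [mvfderiv, projDeriv]
      have := mfderiv_comp (I' := 𝓡 n) ξ hf hp
      erw [this]
      rfl
    rw [h1, mvfderiv_fun_smul (a := fun η : CotangentBundle n M => f η.proj) (hf.comp ξ hp)
      (pairing_mdiff hσ), h2,
      cov.isCovariantDerivativeOn.leibniz hσ hf]
    ext V
    simp [pairing]
    ring
  add {σ σ'} hσ hσ' := by
    have h1 : pairing (σ + σ') = fun η : CotangentBundle n M => pairing σ η + pairing σ' η := by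
      ext η; simp [pairing]
    rw [h1, mvfderiv_fun_add (pairing_mdiff hσ) (pairing_mdiff hσ'),
      cov.isCovariantDerivativeOn.add hσ hσ']
    ext V
    simp
    ring

/-- `connector cov ξ z V` is the value at `z` of the vertical part of `V`. -/
def connector (cov : AffineConnection n M) (ξ : CotangentBundle n M) :
    TangentSpace (𝓡 n) ξ.proj →L[ℝ] TangentSpace (cotangentModel n) ξ →L[ℝ] ℝ :=
  TensorialAt.mkHom _ ξ.proj (connector_tensorial cov ξ)

/-- The vertical projection `v^∇ : T_ξ T*M → T*_x M`. -/
def verticalPart (cov : AffineConnection n M) (ξ : CotangentBundle n M) :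
    TangentSpace (cotangentModel n) ξ →L[ℝ] CotangentSpace n ξ.proj :=
  let B : EuclideanSpace ℝ (Fin n) →L[ℝ]
    (EuclideanSpace ℝ (Fin n) × (EuclideanSpace ℝ (Fin n) →L[ℝ] ℝ)) →L[ℝ] ℝ := connector cov ξ
  B.flip

theorem verticalPart_apply (cov : AffineConnection n M) (ξ : CotangentBundle n M)
    (V : TangentSpace (cotangentModel n) ξ) (z : TangentSpace (𝓡 n) ξ.proj) :
    verticalPart cov ξ V z = connector cov ξ z V := rfl

theorem SmoothField.mdiff {Z : Π x : M, TangentSpace (𝓡 n) x} (hZ : SmoothField Z) (x : M) :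
    MDifferentiableAt (𝓡 n) ((𝓡 n).prod 𝓘(ℝ, EuclideanSpace ℝ (Fin n)))
      (fun x => TotalSpace.mk' (EuclideanSpace ℝ (Fin n)) x (Z x)) x :=
  ContMDiffAt.mdifferentiableAt (ContMDiff.contMDiffAt hZ) (by simp)

theorem connector_apply (cov : AffineConnection n M) (ξ : CotangentBundle n M)
    {Z : Π x : M, TangentSpace (𝓡 n) x} (hZ : SmoothField Z)
    (V : TangentSpace (cotangentModel n) ξ) :
    connector cov ξ (Z ξ.proj) V =
      mvfderiv (cotangentModel n) (pairing Z) ξ V - ξ.2 (cov Z ξ.proj (projDeriv ξ V)) := by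
  have := TensorialAt.mkHom_apply (connector_tensorial cov ξ) (hZ.mdiff ξ.proj)
  exact congrArg (fun A : TangentSpace (cotangentModel n) ξ →L[ℝ] ℝ => A V) this

theorem projDeriv_verticalLift (ξ : CotangentBundle n M) (η : CotangentSpace n ξ.proj) :
    projDeriv ξ (verticalLift ξ η) = 0 := by
  have h1 : MDifferentiableAt (cotangentModel n) (𝓡 n)
      (TotalSpace.proj : CotangentBundle n M → M) ξ :=
      mdifferentiableAt_proj (E := fun x : M => CotangentSpace n x)
  let p₀ : EuclideanSpace ℝ (Fin n) →L[ℝ] ℝ := ξ.2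
  let ι : (EuclideanSpace ℝ (Fin n) →L[ℝ] ℝ) → CotangentBundle n M := fun p => ⟨ξ.proj, p⟩
  have h : mfderiv 𝓘(ℝ, EuclideanSpace ℝ (Fin n) →L[ℝ] ℝ) (𝓡 n)
      ((TotalSpace.proj : CotangentBundle n M → M) ∘ ι) p₀ = projDeriv ξ ∘L verticalLift ξ :=
    mfderiv_comp (I' := cotangentModel n) p₀ h1 (fibre_mdiff ξ.proj p₀)
  have h0 : mfderiv 𝓘(ℝ, EuclideanSpace ℝ (Fin n) →L[ℝ] ℝ) (𝓡 n)
      ((TotalSpace.proj : CotangentBundle n M → M) ∘ ι) p₀ = 0 :=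
    mfderiv_const (c := ξ.proj)
  exact (DFunLike.congr_fun (h.symm.trans h0) η)

theorem connector_verticalLift [T2Space M] (cov : AffineConnection n M) (ξ : CotangentBundle n M)
    (z : TangentSpace (𝓡 n) ξ.proj) (η : CotangentSpace n ξ.proj) :
    connector cov ξ z (verticalLift ξ η) = η z := by
  obtain ⟨Z, hZ, rfl⟩ := exists_smoothField z
  rw [connector_apply cov ξ hZ, projDeriv_verticalLift]
  let p₀ : EuclideanSpace ℝ (Fin n) →L[ℝ] ℝ := ξ.2
  let ι : (EuclideanSpace ℝ (Fin n) →L[ℝ] ℝ) → CotangentBundle n M := fun p => ⟨ξ.proj, p⟩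
  let ev : (EuclideanSpace ℝ (Fin n) →L[ℝ] ℝ) →L[ℝ] ℝ :=
    ContinuousLinearMap.apply ℝ ℝ (Z ξ.proj : EuclideanSpace ℝ (Fin n))
  have h : mfderiv 𝓘(ℝ, EuclideanSpace ℝ (Fin n) →L[ℝ] ℝ) 𝓘(ℝ, ℝ) (pairing Z ∘ ι) p₀
      = mfderiv (cotangentModel n) 𝓘(ℝ, ℝ) (pairing Z) ξ ∘L verticalLift ξ :=
    mfderiv_comp (I' := cotangentModel n) p₀ (pairing_mdiff (hZ.mdiff ξ.proj))
      (fibre_mdiff ξ.proj p₀)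
  have h0 : mfderiv 𝓘(ℝ, EuclideanSpace ℝ (Fin n) →L[ℝ] ℝ) 𝓘(ℝ, ℝ) (pairing Z ∘ ι) p₀ = ev :=
    ev.hasMFDerivAt.mfderiv
  rw [map_zero, map_zero, sub_zero]
  exact (DFunLike.congr_fun (h.symm.trans h0) η)

theorem SmoothForm.mdiff {s : Π x : M, CotangentSpace n x} (hs : SmoothForm s) (x : M) :
    MDifferentiableAt (𝓡 n) (cotangentModel n) (sectionMap s) x :=
  (hs x).mdifferentiableAt (by simp)

theorem projDeriv_section {s : Π x : M, CotangentSpace n x} (hs : SmoothForm s) (x : M)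
    (X : TangentSpace (𝓡 n) x) :
    projDeriv (sectionMap s x) (mfderiv (𝓡 n) (cotangentModel n) (sectionMap s) x X) = X := by
  have h1 : MDifferentiableAt (cotangentModel n) (𝓡 n)
      (TotalSpace.proj : CotangentBundle n M → M) (sectionMap s x) :=
      mdifferentiableAt_proj (E := fun x : M => CotangentSpace n x)
  have h := mfderiv_comp (I' := cotangentModel n) x
    (g := (TotalSpace.proj : CotangentBundle n M → M)) h1 (hs.mdiff x)
  have h0 : (TotalSpace.proj : CotangentBundle n M → M) ∘ sectionMap s = id := rfl
  rw [h0, mfderiv_id] at h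
  exact (DFunLike.congr_fun h X).symm

theorem connector_section (cov : AffineConnection n M) {s : Π x : M, CotangentSpace n x}
    (hs : SmoothForm s) {Z : Π x : M, TangentSpace (𝓡 n) x} (hZ : SmoothField Z)
    (x : M) (X : TangentSpace (𝓡 n) x) :
    connector cov (sectionMap s x) (Z x)
      (mfderiv (𝓡 n) (cotangentModel n) (sectionMap s) x X) = dualDerivative cov s Z x X := by
  refine (connector_apply cov (sectionMap s x) hZ _).trans ?_
  rw [projDeriv_section hs]
  have h := mfderiv_comp (I' := cotangentModel n) x
    (g := pairing Z) (pairing_mdiff (hZ.mdiff x)) (hs.mdiff x)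
  have h2 := DFunLike.congr_fun h X
  unfold dualDerivative
  congr 1
  exact h2.symm

theorem projDeriv_surjective [T2Space M] (ξ : CotangentBundle n M) :
    Function.Surjective (projDeriv ξ) := by
  obtain ⟨x, p⟩ := ξ
  intro X
  obtain ⟨s, hs, rfl⟩ := exists_smoothForm p
  exact ⟨_, projDeriv_section hs x X⟩

theorem ext_of_connector [T2Space M] (cov : AffineConnection n M) (ξ : CotangentBundle n M)
    {V : TangentSpace (cotangentModel n) ξ} (h1 : projDeriv ξ V = 0)
    (h2 : ∀ z, connector cov ξ z V = 0) : V = 0 := by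
  let A : (EuclideanSpace ℝ (Fin n) × (EuclideanSpace ℝ (Fin n) →L[ℝ] ℝ)) →ₗ[ℝ]
    EuclideanSpace ℝ (Fin n) := (projDeriv ξ).toLinearMap
  let B : (EuclideanSpace ℝ (Fin n) →L[ℝ] ℝ) →ₗ[ℝ]
    (EuclideanSpace ℝ (Fin n) × (EuclideanSpace ℝ (Fin n) →L[ℝ] ℝ)) :=
    (verticalLift ξ).toLinearMap
  have hB : Function.Injective B := by
    rw [injective_iff_map_eq_zero]
    intro η hη
    refine ContinuousLinearMap.ext fun z => ?_
    have h := connector_verticalLift cov ξ z η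
    have h' : verticalLift ξ η = 0 := hη
    exact (h.symm.trans (congrArg (connector cov ξ z) h')).trans
      (ContinuousLinearMap.map_zero (connector cov ξ z))
  have hA : LinearMap.range A = ⊤ := LinearMap.range_eq_top.2 (projDeriv_surjective ξ)
  have hle : LinearMap.range B ≤ LinearMap.ker A := by
    rintro _ ⟨η, rfl⟩
    exact projDeriv_verticalLift ξ η
  have hdim : Module.finrank ℝ (LinearMap.ker A) ≤ Module.finrank ℝ (LinearMap.range B) := by
    have e1 := LinearMap.finrank_range_add_finrank_ker A
    rw [hA, finrank_top, Module.finrank_prod] at e1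
    rw [LinearMap.finrank_range_of_inj hB]
    omega
  have heq := Submodule.eq_of_le_of_finrank_le hle hdim
  have hV : V ∈ LinearMap.ker A := h1
  rw [← heq] at hV
  obtain ⟨η, hη⟩ := hV
  have hη' : verticalLift ξ η = V := hη
  have h0 : (η : CotangentSpace n ξ.proj) = 0 := by
    refine ContinuousLinearMap.ext fun z => ?_
    have h := connector_verticalLift cov ξ z η
    exact (h.symm.trans (congrArg (connector cov ξ z) hη')).trans (h2 z)
  exact hη'.symm.trans ((congrArg (verticalLift ξ) h0).trans
    (ContinuousLinearMap.map_zero (verticalLift ξ)))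

theorem connector_of_mem [T2Space M] (cov : AffineConnection n M) (ξ : CotangentBundle n M)
    {V : TangentSpace (cotangentModel n) ξ} (hV : V ∈ horizontalSpace cov ξ)
    (z : TangentSpace (𝓡 n) ξ.proj) : connector cov ξ z V = 0 := by
  obtain ⟨x, p⟩ := ξ
  obtain ⟨s, X, hs, hp, hd, hV⟩ := hV
  change s x = p at hp
  subst hp
  obtain ⟨Z, hZ, rfl⟩ := exists_smoothField z
  have hV' : mfderiv (𝓡 n) (cotangentModel n) (sectionMap s) x X = V :=
    eq_of_heq (TotalSpace.mk.inj hV).2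
  subst hV'
  exact (connector_section cov hs hZ x X).trans (hd Z hZ)

theorem exists_horizontal [T2Space M] (cov : AffineConnection n M) (ξ : CotangentBundle n M)
    (X : TangentSpace (𝓡 n) ξ.proj) :
    ∃ V ∈ horizontalSpace cov ξ, projDeriv ξ V = X := by
  obtain ⟨x, p⟩ := ξ
  change TangentSpace (𝓡 n) x at X
  suffices h : ∃ s : Π x : M, CotangentSpace n x, SmoothForm s ∧ s x = p ∧
      ∀ Z : Π x : M, TangentSpace (𝓡 n) x, SmoothField Z → dualDerivative cov s Z x X = 0 by
    obtain ⟨s, hs, rfl, hd⟩ := h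
    exact ⟨mfderiv (𝓡 n) (cotangentModel n) (sectionMap s) x X,
      ⟨s, X, hs, rfl, hd, rfl⟩, projDeriv_section hs x X⟩
  obtain ⟨s, hs, rfl⟩ := exists_smoothForm p
  by_cases hX : X = 0
  · subst hX
    exact ⟨s, hs, rfl, fun Z _ => by simp [dualDerivative]⟩
  obtain ⟨g, hg, hgx, hgX⟩ := exists_function hX
  let η : CotangentSpace n x :=
    verticalPart cov (sectionMap s x)
      (mfderiv (𝓡 n) (cotangentModel n) (sectionMap s) x X)
  obtain ⟨σ, hσ, hση⟩ := exists_smoothForm η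
  refine ⟨s - g • σ, ?_, ?_, ?_⟩
  · exact ContMDiff.sub_section hs (ContMDiff.smul_section hg hσ)
  · simp [hgx]
  · intro Z hZ
    have hc := connector_section cov hs hZ x X
    have hη : σ x (Z x) = dualDerivative cov s Z x X := by
      rw [hση, ← hc]; exact verticalPart_apply cov (sectionMap s x) _ _
    have d1 : MDifferentiableAt (𝓡 n) 𝓘(ℝ, ℝ) (fun y => s y (Z y)) x :=
      (pairing_mdiff (ξ := sectionMap s x) (hZ.mdiff x)).comp x (hs.mdiff x)
    have d2 : MDifferentiableAt (𝓡 n) 𝓘(ℝ, ℝ) (fun y => σ y (Z y)) x :=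
      (pairing_mdiff (ξ := sectionMap σ x) (hZ.mdiff x)).comp x (hσ.mdiff x)
    have d3 : MDifferentiableAt (𝓡 n) 𝓘(ℝ, ℝ) g x := (hg x).mdifferentiableAt (by simp)
    have h0 : (fun y => (s - g • σ) y (Z y)) = fun y => s y (Z y) - g y • σ y (Z y) := by
      ext y; simp
    unfold dualDerivative at hη ⊢
    have d4 : MDifferentiableAt (𝓡 n) 𝓘(ℝ, ℝ) (fun y => g y • σ y (Z y)) x := d3.smul d2
    rw [h0, mvfderiv_fun_sub d1 d4, mvfderiv_fun_smul d3 d2]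
    simp [hgx, hgX, hη]

theorem mem_horizontalSpace [T2Space M] (cov : AffineConnection n M) (ξ : CotangentBundle n M)
    (V : TangentSpace (cotangentModel n) ξ) :
    V ∈ horizontalSpace cov ξ ↔ ∀ z, connector cov ξ z V = 0 := by
  refine ⟨connector_of_mem cov ξ, fun h => ?_⟩
  obtain ⟨W, hW, hWV⟩ := exists_horizontal cov ξ (projDeriv ξ V)
  have h0 : V - W = 0 := ext_of_connector cov ξ (by
    rw [ContinuousLinearMap.map_sub, hWV, sub_self])
    (fun z => by
      rw [ContinuousLinearMap.map_sub, h, connector_of_mem cov ξ hW, sub_zero])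
  rwa [sub_eq_zero.1 h0]

/-- `A` is the product structure `J ⊕ ᵗJ` in the splitting `T_ξ T*M = H_ξ ⊕ T*_x M`. -/
structure IsProductLift (J : Π x : M, TangentSpace (𝓡 n) x →L[ℝ] TangentSpace (𝓡 n) x)
    (cov : AffineConnection n M) (ξ : CotangentBundle n M)
    (A : TangentSpace (cotangentModel n) ξ →L[ℝ] TangentSpace (cotangentModel n) ξ) : Prop where
  mem_horizontal : ∀ V ∈ horizontalSpace cov ξ, A V ∈ horizontalSpace cov ξ
  projDeriv_horizontal : ∀ V ∈ horizontalSpace cov ξ,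
    projDeriv ξ (A V) = J ξ.proj (projDeriv ξ V)
  vertical : ∀ η : CotangentSpace n ξ.proj,
    A (verticalLift ξ η) = verticalLift ξ (η ∘L J ξ.proj)

theorem existsUnique_isProductLift [T2Space M]
    (J : Π x : M, TangentSpace (𝓡 n) x →L[ℝ] TangentSpace (𝓡 n) x)
    (cov : AffineConnection n M) (ξ : CotangentBundle n M) :
    ∃! A, IsProductLift J cov ξ A := by
  let J₀ : EuclideanSpace ℝ (Fin n) →L[ℝ] EuclideanSpace ℝ (Fin n) := J ξ.proj
  obtain ⟨A, ⟨h1, h2, h3⟩, hA⟩ := existsUnique_product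
    (T := EuclideanSpace ℝ (Fin n) × (EuclideanSpace ℝ (Fin n) →L[ℝ] ℝ))
    (X := EuclideanSpace ℝ (Fin n)) (C := EuclideanSpace ℝ (Fin n) →L[ℝ] ℝ)
    (projDeriv ξ) (verticalPart cov ξ) (verticalLift ξ) (horizontalSpace cov ξ)
    J₀ ((ContinuousLinearMap.compL ℝ _ _ ℝ).flip J₀)
    (projDeriv_verticalLift ξ)
    (fun η => ContinuousLinearMap.ext fun z => connector_verticalLift cov ξ z η)
    (fun V => (mem_horizontalSpace cov ξ V).trans
      ⟨fun h => ContinuousLinearMap.ext h, fun h z => DFunLike.congr_fun h z⟩)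
    (exists_horizontal cov ξ)
    (fun V h1 h2 => ext_of_connector cov ξ h1 (fun z => DFunLike.congr_fun h2 z))
  exact ⟨A, ⟨h1, h2, h3⟩, fun B hB => hA B ⟨hB.1, hB.2, hB.3⟩⟩

end Defs

/-! ### Almost complex structures, holomorphic maps and lifts -/

/-- An almost complex structure: a smooth field `J` of endomorphisms of `TM` with `J² = -id`. -/
structure AlmostComplexStructure (n : ℕ) (M : Type*) [TopologicalSpace M]
    [ChartedSpace (EuclideanSpace ℝ (Fin n)) M] [IsManifold (𝓡 n) ∞ M] where
  /-- The endomorphism `J(x)` of `T_x M`. -/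
  toFun : Π x : M, TangentSpace (𝓡 n) x →L[ℝ] TangentSpace (𝓡 n) x
  smooth : ContMDiff (𝓡 n)
    ((𝓡 n).prod 𝓘(ℝ, EuclideanSpace ℝ (Fin n) →L[ℝ] EuclideanSpace ℝ (Fin n))) ∞
    (fun x => TotalSpace.mk' (EuclideanSpace ℝ (Fin n) →L[ℝ] EuclideanSpace ℝ (Fin n))
      (E := fun x : M => TangentSpace (𝓡 n) x →L[ℝ] TangentSpace (𝓡 n) x) x (toFun x))
  sq_eq_neg_id : ∀ (x : M) (X : TangentSpace (𝓡 n) x), toFun x (toFun x X) = -X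

/-- A smooth map `f : N → N'` is `(A, A')`-holomorphic if `A'(f(x)) ∘ d_x f = d_x f ∘ A(x)` for
all `x`, where `A`, `A'` are fields of endomorphisms of the tangent spaces. -/
def IsHolomorphic {E E' H H' N N' : Type*} [NormedAddCommGroup E] [NormedSpace ℝ E]
    [TopologicalSpace H] (I : ModelWithCorners ℝ E H) [TopologicalSpace N] [ChartedSpace H N]
    [NormedAddCommGroup E'] [NormedSpace ℝ E'] [TopologicalSpace H']
    (I' : ModelWithCorners ℝ E' H') [TopologicalSpace N'] [ChartedSpace H' N']
    (A : Π x : N, TangentSpace I x →L[ℝ] TangentSpace I x)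
    (A' : Π y : N', TangentSpace I' y →L[ℝ] TangentSpace I' y) (f : N → N') : Prop :=
  ContMDiff I I' ∞ f ∧ ∀ x : N, A' (f x) ∘L mfderiv I I' f x = mfderiv I I' f x ∘L A x

section Main

variable {n : ℕ} {M : Type*} [TopologicalSpace M]
    [ChartedSpace (EuclideanSpace ℝ (Fin n)) M] [IsManifold (𝓡 n) ∞ M]

/-- The generalized horizontal lift `J^{G,∇}`: at `ξ ∈ T*M` it is the unique endomorphism of
`T_ξ T*M` that equals `J ⊕ ᵗJ` in the splitting `T_ξ T*M = H_ξ ⊕ T*_x M`. -/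
def generalizedHorizontalLift [T2Space M] (J : AlmostComplexStructure n M)
    (cov : AffineConnection n M) (ξ : CotangentBundle n M) :
    TangentSpace (cotangentModel n) ξ →L[ℝ] TangentSpace (cotangentModel n) ξ :=
  (existsUnique_isProductLift J.toFun cov ξ).choose

theorem generalizedHorizontalLift_spec [T2Space M] (J : AlmostComplexStructure n M)
    (cov : AffineConnection n M) (ξ : CotangentBundle n M) :
    IsProductLift J.toFun cov ξ (generalizedHorizontalLift J cov ξ) :=
  (existsUnique_isProductLift J.toFun cov ξ).choose_spec.1

theorem AlmostComplexStructure.mdiff_apply (J : AlmostComplexStructure n M)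
    {Z : Π x : M, TangentSpace (𝓡 n) x} {x : M}
    (hZ : MDifferentiableAt (𝓡 n) ((𝓡 n).prod 𝓘(ℝ, EuclideanSpace ℝ (Fin n)))
      (fun x => TotalSpace.mk' (EuclideanSpace ℝ (Fin n)) x (Z x)) x) :
    MDifferentiableAt (𝓡 n) ((𝓡 n).prod 𝓘(ℝ, EuclideanSpace ℝ (Fin n)))
      (fun x => TotalSpace.mk' (EuclideanSpace ℝ (Fin n)) x (J.toFun x (Z x))) x :=
  MDifferentiableAt.clm_bundle_apply (IB := 𝓡 n) (F₁ := EuclideanSpace ℝ (Fin n))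
    (F₂ := EuclideanSpace ℝ (Fin n)) (E₁ := (TangentSpace (𝓡 n) : M → Type _))
    (E₂ := (TangentSpace (𝓡 n) : M → Type _)) (b := fun x : M => x) (ϕ := J.toFun) (v := Z)
    (ContMDiffAt.mdifferentiableAt (ContMDiff.contMDiffAt J.smooth) (by simp)) hZ

theorem nablaJ_tensorial (J : AlmostComplexStructure n M) (cov : AffineConnection n M) (x : M) :
    TensorialAt (𝓡 n) (EuclideanSpace ℝ (Fin n))
      (fun Y : Π x : M, TangentSpace (𝓡 n) x =>
        cov (fun y => J.toFun y (Y y)) x - J.toFun x ∘L cov Y x) x where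
  smul {f σ} hf hσ := by
    have h1 : (fun y => J.toFun y ((f • σ) y)) = f • fun y => J.toFun y (σ y) := by
      ext1 y
      exact (J.toFun y).map_smul (f y) (σ y)
    rw [h1, cov.isCovariantDerivativeOn.leibniz hσ hf,
      cov.isCovariantDerivativeOn.leibniz (J.mdiff_apply hσ) hf]
    refine ContinuousLinearMap.ext fun V => ?_
    simp [smul_sub]
  add {σ σ'} hσ hσ' := by
    have h1 : (fun y => J.toFun y ((σ + σ') y)) =
        (fun y => J.toFun y (σ y)) + fun y => J.toFun y (σ' y) := by
      ext1 y
      exact (J.toFun y).map_add (σ y) (σ' y)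
    rw [h1, cov.isCovariantDerivativeOn.add hσ hσ',
      cov.isCovariantDerivativeOn.add (J.mdiff_apply hσ) (J.mdiff_apply hσ')]
    refine ContinuousLinearMap.ext fun V => ?_
    simp
    abel

/-- The tensor `(∇J)(X, Y) = ∇_X (JY) - J ∇_X Y`. -/
def nablaJ (J : AlmostComplexStructure n M) (cov : AffineConnection n M) (x : M)
    (X Y : TangentSpace (𝓡 n) x) : TangentSpace (𝓡 n) x :=
  TensorialAt.mkHom _ x (nablaJ_tensorial J cov x) Y X

/-- `nablaJ` computes the difference `∇_X (JY) - J ∇_X Y` on vector fields. -/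
theorem nablaJ_apply (J : AlmostComplexStructure n M) (cov : AffineConnection n M)
    {Y : Π x : M, TangentSpace (𝓡 n) x} (hY : SmoothField Y) (x : M)
    (X : TangentSpace (𝓡 n) x) :
    nablaJ J cov x X (Y x) = cov (fun y => J.toFun y (Y y)) x X - J.toFun x (cov Y x X) :=
  DFunLike.congr_fun (TensorialAt.mkHom_apply (nablaJ_tensorial J cov x) (hY.mdiff x)) X

/-- The tensor `S(X, Y) = -(∇J)(X, Y) + (∇J)(Y, X) + T(JX, Y) - J T(X, Y)`, where `T` is the
torsion of `∇`. -/
def tensorS (J : AlmostComplexStructure n M) (cov : AffineConnection n M) (x : M)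
    (X Y : TangentSpace (𝓡 n) x) : TangentSpace (𝓡 n) x :=
  -nablaJ J cov x X Y + nablaJ J cov x Y X + cov.torsion x (J.toFun x X) Y
    - J.toFun x (cov.torsion x X Y)

variable {n' : ℕ} {M' : Type*} [TopologicalSpace M']
    [ChartedSpace (EuclideanSpace ℝ (Fin n')) M'] [IsManifold (𝓡 n') ∞ M']

/-- The differential `d_x f` of a diffeomorphism, as an isomorphism `T_x M ≃ T_{f(x)} M'`. -/
def diffeoDeriv (f : M ≃ₘ^∞⟮𝓡 n, 𝓡 n'⟯ M') (x : M) :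
    TangentSpace (𝓡 n) x ≃L[ℝ] TangentSpace (𝓡 n') (f x) :=
  f.mfderivToContinuousLinearEquiv (by simp) x

/-- The lift `f̃ = (f, ᵗ(df)⁻¹)` of a diffeomorphism to the cotangent bundles. -/
def cotangentLift (f : M ≃ₘ^∞⟮𝓡 n, 𝓡 n'⟯ M') (ξ : CotangentBundle n M) : CotangentBundle n' M' :=
  ⟨f ξ.proj, ξ.2 ∘L ((diffeoDeriv f ξ.proj).symm :
    TangentSpace (𝓡 n') (f ξ.proj) →L[ℝ] TangentSpace (𝓡 n) ξ.proj)⟩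

/-- The direct image of a tensor field `S` of type `(1,2)` under a diffeomorphism `f`, at the point
`f(x)` (every point of `M'` is of this form for exactly one `x`):
`(f_* S)(X, Y) = d_x f (S((d_x f)⁻¹ X, (d_x f)⁻¹ Y))`. -/
def pushforwardAt (f : M ≃ₘ^∞⟮𝓡 n, 𝓡 n'⟯ M')
    (S : Π x : M, TangentSpace (𝓡 n) x → TangentSpace (𝓡 n) x → TangentSpace (𝓡 n) x) (x : M)
    (X Y : TangentSpace (𝓡 n') (f x)) : TangentSpace (𝓡 n') (f x) :=
  diffeoDeriv f x (S x ((diffeoDeriv f x).symm X) ((diffeoDeriv f x).symm Y))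

end Main

end CotangentLift

end

namespace CotangentLift

section Lift

variable {n : ℕ} {M : Type*} [TopologicalSpace M]
    [ChartedSpace (EuclideanSpace ℝ (Fin n)) M] [IsManifold (𝓡 n) ∞ M]

/-- Two tangent vectors of `T*M` agree if their horizontal and vertical parts do. -/
theorem eq_of_connector [T2Space M] (cov : AffineConnection n M) (ξ : CotangentBundle n M)
    {V W : TangentSpace (cotangentModel n) ξ} (h1 : projDeriv ξ V = projDeriv ξ W)
    (h2 : ∀ z, connector cov ξ z V = connector cov ξ z W) : V = W :=
  sub_eq_zero.1 (ext_of_connector cov ξ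
    (by rw [ContinuousLinearMap.map_sub, h1, sub_self])
    (fun z => by rw [ContinuousLinearMap.map_sub, h2, sub_self]))

theorem exists_horizontal_add_verticalLift [T2Space M] (cov : AffineConnection n M)
    (ξ : CotangentBundle n M) (V : TangentSpace (cotangentModel n) ξ) :
    ∃ H ∈ horizontalSpace cov ξ, projDeriv ξ H = projDeriv ξ V ∧
      V = H + verticalLift ξ (verticalPart cov ξ V) := by
  obtain ⟨H, hH, hHV⟩ := exists_horizontal cov ξ (projDeriv ξ V)
  refine ⟨H, hH, hHV, eq_of_connector cov ξ ?_ fun z => ?_⟩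
  · rw [ContinuousLinearMap.map_add, projDeriv_verticalLift, hHV, add_zero]
  · rw [ContinuousLinearMap.map_add, connector_verticalLift, connector_of_mem cov ξ hH, zero_add,
      verticalPart_apply]

theorem IsProductLift.projDeriv_apply [T2Space M]
    {J : Π x : M, TangentSpace (𝓡 n) x →L[ℝ] TangentSpace (𝓡 n) x}
    {cov : AffineConnection n M} {ξ : CotangentBundle n M}
    {A : TangentSpace (cotangentModel n) ξ →L[ℝ] TangentSpace (cotangentModel n) ξ}
    (hA : IsProductLift J cov ξ A) (V : TangentSpace (cotangentModel n) ξ) :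
    projDeriv ξ (A V) = J ξ.proj (projDeriv ξ V) := by
  obtain ⟨H, hH, hHV, hV⟩ := exists_horizontal_add_verticalLift cov ξ V
  have h : A V = A H + verticalLift ξ (verticalPart cov ξ V ∘L J ξ.proj) := by
    conv_lhs => rw [hV]
    rw [ContinuousLinearMap.map_add, hA.vertical]
  rw [h, ContinuousLinearMap.map_add, projDeriv_verticalLift, add_zero,
    hA.projDeriv_horizontal H hH, hHV]

theorem IsProductLift.connector_apply [T2Space M]
    {J : Π x : M, TangentSpace (𝓡 n) x →L[ℝ] TangentSpace (𝓡 n) x}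
    {cov : AffineConnection n M} {ξ : CotangentBundle n M}
    {A : TangentSpace (cotangentModel n) ξ →L[ℝ] TangentSpace (cotangentModel n) ξ}
    (hA : IsProductLift J cov ξ A) (z : TangentSpace (𝓡 n) ξ.proj)
    (V : TangentSpace (cotangentModel n) ξ) :
    connector cov ξ z (A V) = connector cov ξ (J ξ.proj z) V := by
  obtain ⟨H, hH, hHV, hV⟩ := exists_horizontal_add_verticalLift cov ξ V
  have h : A V = A H + verticalLift ξ (verticalPart cov ξ V ∘L J ξ.proj) := by
    conv_lhs => rw [hV]
    rw [ContinuousLinearMap.map_add, hA.vertical]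
  rw [h, ContinuousLinearMap.map_add, connector_verticalLift,
    connector_of_mem cov ξ (hA.mem_horizontal H hH), zero_add]
  exact verticalPart_apply cov ξ V (J ξ.proj z)

/-- Tangent vectors of `T*M` are separated by `dπ` and the differentials of the functions
`η ↦ η(Z)`. -/
theorem eq_of_mvfderiv_pairing [T2Space M] (cov : AffineConnection n M) (ξ : CotangentBundle n M)
    {V W : TangentSpace (cotangentModel n) ξ} (h1 : projDeriv ξ V = projDeriv ξ W)
    (h2 : ∀ Z : Π x : M, TangentSpace (𝓡 n) x, SmoothField Z →
      mvfderiv (cotangentModel n) (pairing Z) ξ V = mvfderiv (cotangentModel n) (pairing Z) ξ W) :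
    V = W := by
  refine eq_of_connector cov ξ h1 fun z => ?_
  obtain ⟨Z, hZ, rfl⟩ := exists_smoothField z
  rw [CotangentLift.connector_apply cov ξ hZ, CotangentLift.connector_apply cov ξ hZ, h1, h2 Z hZ]

theorem AlmostComplexStructure.smoothField_apply (J : AlmostComplexStructure n M)
    {Z : Π x : M, TangentSpace (𝓡 n) x} (hZ : SmoothField Z) :
    SmoothField fun x => J.toFun x (Z x) :=
  ContMDiff.clm_bundle_apply (IB := 𝓡 n) (F₁ := EuclideanSpace ℝ (Fin n))
    (F₂ := EuclideanSpace ℝ (Fin n)) (E₁ := (TangentSpace (𝓡 n) : M → Type _))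
    (E₂ := (TangentSpace (𝓡 n) : M → Type _)) (b := fun x : M => x) (ϕ := J.toFun) (v := Z)
    J.smooth hZ

/-- `S(X, Z) = ∇_{JX} Z - ∇_X (JZ) - [JX, Z] + J[X, Z]`. -/
theorem tensorS_apply (J : AlmostComplexStructure n M) (cov : AffineConnection n M)
    {X Z : Π x : M, TangentSpace (𝓡 n) x} (hX : SmoothField X) (hZ : SmoothField Z) (x : M) :
    tensorS J cov x (X x) (Z x) =
      cov Z x (J.toFun x (X x)) - cov (fun y => J.toFun y (Z y)) x (X x)
        - VectorField.mlieBracket (𝓡 n) (fun y => J.toFun y (X y)) Z x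
        + J.toFun x (VectorField.mlieBracket (𝓡 n) X Z x) := by
  have hT := cov.torsion_apply (hX.mdiff x) (hZ.mdiff x)
  have hTJ := cov.torsion_apply ((J.smoothField_apply hX).mdiff x) (hZ.mdiff x)
  rw [tensorS, nablaJ_apply J cov hZ, nablaJ_apply J cov hX, hT, hTJ, map_sub, map_sub]
  abel

/-- The differential of `η ↦ η(Z)` along the generalized horizontal lift. -/
theorem mvfderiv_pairing_generalizedHorizontalLift [T2Space M] (J : AlmostComplexStructure n M)
    (cov : AffineConnection n M) {X Z : Π x : M, TangentSpace (𝓡 n) x} (hX : SmoothField X)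
    (hZ : SmoothField Z) (ξ : CotangentBundle n M) (V : TangentSpace (cotangentModel n) ξ)
    (hV : projDeriv ξ V = X ξ.proj) :
    mvfderiv (cotangentModel n) (pairing Z) ξ (generalizedHorizontalLift J cov ξ V) =
      mvfderiv (cotangentModel n) (pairing fun x => J.toFun x (Z x)) ξ V
        + ξ.2 (tensorS J cov ξ.proj (X ξ.proj) (Z ξ.proj)
          + VectorField.mlieBracket (𝓡 n) (fun y => J.toFun y (X y)) Z ξ.proj
          - J.toFun ξ.proj (VectorField.mlieBracket (𝓡 n) X Z ξ.proj)) := by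
  have hA := generalizedHorizontalLift_spec J cov ξ
  have h1 := hA.connector_apply (Z ξ.proj) V
  rw [connector_apply cov ξ hZ, connector_apply cov ξ (J.smoothField_apply hZ),
    hA.projDeriv_apply, hV] at h1
  rw [tensorS_apply J cov hX hZ, map_sub, map_add, map_add, map_sub, map_sub]
  linarith

theorem isHolomorphic_proj [T2Space M] (J : AlmostComplexStructure n M)
    (cov : AffineConnection n M) :
    IsHolomorphic (cotangentModel n) (𝓡 n) (generalizedHorizontalLift J cov) J.toFun
      (fun ξ : CotangentBundle n M => ξ.proj) :=
  ⟨contMDiff_proj (fun x : M => CotangentSpace n x), fun ξ => ContinuousLinearMap.ext fun V =>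
    ((generalizedHorizontalLift_spec J cov ξ).projDeriv_apply V).symm⟩

theorem smoothForm_zero : SmoothForm (0 : Π x : M, CotangentSpace n x) :=
  contMDiff_zeroSection ℝ (fun x : M => CotangentSpace n x)

theorem isHolomorphic_zeroSection [T2Space M] (J : AlmostComplexStructure n M)
    (cov : AffineConnection n M) :
    IsHolomorphic (𝓡 n) (cotangentModel n) J.toFun (generalizedHorizontalLift J cov)
      (fun x : M => (⟨x, 0⟩ : CotangentBundle n M)) := by
  refine ⟨smoothForm_zero, fun x => ContinuousLinearMap.ext fun X => ?_⟩
  let o : Π x : M, CotangentSpace n x := 0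
  let d := mfderiv (𝓡 n) (cotangentModel n) (sectionMap o) x
  have hd : ∀ Y z, connector cov (sectionMap o x) z (d Y) = 0 := by
    intro Y z
    obtain ⟨Z, hZ, rfl⟩ := exists_smoothField (x := x) z
    refine (connector_section cov smoothForm_zero hZ x Y).trans ?_
    have h0 : (fun y => o y (Z y)) = fun _ => (0 : ℝ) := rfl
    have h1 : mfderiv (𝓡 n) 𝓘(ℝ, ℝ) (fun y => o y (Z y)) x = 0 := by
      rw [h0]; exact mfderiv_const
    have h2 : mvfderiv (𝓡 n) (fun y => o y (Z y)) x Y = 0 := DFunLike.congr_fun h1 Y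
    rw [dualDerivative, h2]
    exact sub_zero _
  have hA := generalizedHorizontalLift_spec J cov (sectionMap o x)
  refine eq_of_connector cov (sectionMap o x)
    (V := generalizedHorizontalLift J cov (sectionMap o x) (d X)) (W := d (J.toFun x X)) ?_ ?_
  · rw [hA.projDeriv_apply]
    exact (congrArg (J.toFun x) (projDeriv_section smoothForm_zero x X)).trans
      (projDeriv_section smoothForm_zero x (J.toFun x X)).symm
  · intro z
    rw [hA.connector_apply]
    exact (hd X _).trans (hd _ z).symm

end Lift

section Diffeo

variable {n : ℕ} {M : Type*} [TopologicalSpace M]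
    [ChartedSpace (EuclideanSpace ℝ (Fin n)) M] [IsManifold (𝓡 n) ∞ M]
    {n' : ℕ} {M' : Type*} [TopologicalSpace M']
    [ChartedSpace (EuclideanSpace ℝ (Fin n')) M'] [IsManifold (𝓡 n') ∞ M']
    (f : M ≃ₘ^∞⟮𝓡 n, 𝓡 n'⟯ M')

theorem mdifferentiableAt_diffeo (x : M) : MDifferentiableAt (𝓡 n) (𝓡 n') f x :=
  f.contMDiff.mdifferentiableAt (by simp)

theorem diffeoDeriv_symm_eq_mfderiv (x : M) :
    (((diffeoDeriv f x).symm : TangentSpace (𝓡 n') (f x) →L[ℝ] TangentSpace (𝓡 n) x) :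
      EuclideanSpace ℝ (Fin n') →L[ℝ] EuclideanSpace ℝ (Fin n)) =
    mfderiv (𝓡 n') (𝓡 n) f.symm (f x) := by
  have h := mfderiv_comp (I' := 𝓡 n') x
    (f.symm.contMDiff.mdifferentiableAt (x := f x) (by simp)) (mdifferentiableAt_diffeo f x)
  have h0 : f.symm ∘ f = id := funext f.symm_apply_apply
  rw [h0, mfderiv_id] at h
  refine ContinuousLinearMap.ext fun Y => ?_
  obtain ⟨X, rfl⟩ := (diffeoDeriv f x).surjective Y
  exact ((diffeoDeriv f x).symm_apply_apply X).trans (DFunLike.congr_fun h X)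

theorem inCoordinates_trivial_apply {B B' F G : Type*} [TopologicalSpace B] [TopologicalSpace B']
    [NormedAddCommGroup F] [NormedSpace ℝ F] [NormedAddCommGroup G] [NormedSpace ℝ G]
    {E : B → Type*} [∀ x, AddCommGroup (E x)] [∀ x, Module ℝ (E x)]
    [∀ x, TopologicalSpace (E x)] [TopologicalSpace (TotalSpace F E)] [FiberBundle F E]
    [VectorBundle ℝ F E] (x₀ x : B) (y₀ y : B') (φ : E x →L[ℝ] G) (v : F) :
    ContinuousLinearMap.inCoordinates F E G (Bundle.Trivial B' G) x₀ x y₀ y φ v =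
      φ ((trivializationAt F E x₀).symmL ℝ x v) := by
  have h : (trivializationAt G (Bundle.Trivial B' G) y₀).continuousLinearMapAt ℝ y =
      ContinuousLinearMap.id ℝ G := Bundle.Trivial.continuousLinearMapAt_trivialization ℝ B' G y
  rw [ContinuousLinearMap.inCoordinates, h]
  rfl

theorem contMDiffAt_inTangentCoordinates_diffeoDeriv_symm (x₀ : M) :
    ContMDiffAt (𝓡 n) 𝓘(ℝ, EuclideanSpace ℝ (Fin n') →L[ℝ] EuclideanSpace ℝ (Fin n)) ∞
      (inTangentCoordinates (𝓡 n') (𝓡 n) f id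
        (fun x => ((diffeoDeriv f x).symm :
          TangentSpace (𝓡 n') (f x) →L[ℝ] TangentSpace (𝓡 n) x)) x₀) x₀ := by
  have h := ContMDiffAt.mfderiv (n := ∞) (m := ∞) (I := 𝓡 n') (I' := 𝓡 n) (J := 𝓡 n)
    (x₀ := x₀) (fun _ : M => f.symm) f
    (f.symm.contMDiff.contMDiffAt.comp (x₀, f x₀) contMDiffAt_snd)
    f.contMDiff.contMDiffAt (by simp)
  have h0 : (fun x => f.symm (f x)) = id := funext f.symm_apply_apply
  have h3 : (fun x => mfderiv (𝓡 n') (𝓡 n) f.symm (f x)) = fun x =>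
      (((diffeoDeriv f x).symm : TangentSpace (𝓡 n') (f x) →L[ℝ] TangentSpace (𝓡 n) x) :
        EuclideanSpace ℝ (Fin n') →L[ℝ] EuclideanSpace ℝ (Fin n)) :=
    funext fun x => (diffeoDeriv_symm_eq_mfderiv f x).symm
  rw [h0] at h
  exact h3 ▸ h

theorem inCoordinates_cotangentLift (x₀ : M) (ξ : CotangentBundle n M)
    (hξ : ξ.proj ∈
      (trivializationAt (EuclideanSpace ℝ (Fin n)) (TangentSpace (𝓡 n)) x₀).baseSet) :
    ContinuousLinearMap.inCoordinates (EuclideanSpace ℝ (Fin n')) (TangentSpace (𝓡 n')) ℝ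
        (Bundle.Trivial M' ℝ) (f x₀) (f ξ.proj) (f x₀) (f ξ.proj) (cotangentLift f ξ).2 =
      ContinuousLinearMap.inCoordinates (EuclideanSpace ℝ (Fin n)) (TangentSpace (𝓡 n)) ℝ
        (Bundle.Trivial M ℝ) x₀ ξ.proj x₀ ξ.proj ξ.2 ∘L
      inTangentCoordinates (𝓡 n') (𝓡 n) f id
        (fun x => ((diffeoDeriv f x).symm :
          TangentSpace (𝓡 n') (f x) →L[ℝ] TangentSpace (𝓡 n) x)) x₀ ξ.proj := by
  refine ContinuousLinearMap.ext fun v => ?_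
  rw [ContinuousLinearMap.comp_apply, inCoordinates_trivial_apply]
  refine (inCoordinates_trivial_apply (f x₀) (f ξ.proj) (f x₀) (f ξ.proj)
    (cotangentLift f ξ).2 v).trans ?_
  exact congrArg ξ.2 ((trivializationAt (EuclideanSpace ℝ (Fin n)) (TangentSpace (𝓡 n))
    x₀).symmL_continuousLinearMapAt (R := ℝ) hξ _).symm

theorem contMDiff_cotangentLift :
    ContMDiff (cotangentModel n) (cotangentModel n') ∞ (cotangentLift f) := by
  intro ξ₀
  have hp : ContMDiffAt (cotangentModel n) (𝓡 n) ∞ (fun ξ : CotangentBundle n M => ξ.proj) ξ₀ :=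
    contMDiff_proj (fun x : M => CotangentSpace n x) ξ₀
  have hfp : ContMDiffAt (cotangentModel n) (𝓡 n') ∞
      (fun ξ : CotangentBundle n M => f ξ.proj) ξ₀ :=
    f.contMDiff.contMDiffAt.comp ξ₀ hp
  have h1 := ((contMDiffAt_hom_bundle (n := ∞) (IB := 𝓡 n) (IM := cotangentModel n)
    (E₁ := (TangentSpace (𝓡 n) : M → Type _))
    (E₂ := Bundle.Trivial M ℝ) (fun ξ : CotangentBundle n M => ξ) (x₀ := ξ₀)).1 contMDiffAt_id).2
  have h2 := (contMDiffAt_inTangentCoordinates_diffeoDeriv_symm f ξ₀.proj).comp ξ₀ hp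
  refine (contMDiffAt_hom_bundle (n := ∞) (IB := 𝓡 n') (IM := cotangentModel n)
    (E₁ := (TangentSpace (𝓡 n') : M' → Type _))
    (E₂ := Bundle.Trivial M' ℝ) (cotangentLift f)).2 ⟨hfp, ?_⟩
  refine (h1.clm_comp h2).congr_of_eventuallyEq ?_
  have hs := hp.continuousAt.eventually ((trivializationAt (EuclideanSpace ℝ (Fin n))
    (TangentSpace (𝓡 n)) ξ₀.proj).open_baseSet.mem_nhds
    (FiberBundle.mem_baseSet_trivializationAt' _))
  exact hs.mono fun ξ hξ => inCoordinates_cotangentLift f ξ₀.proj ξ hξ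

theorem mpullback_eq_diffeoDeriv_symm (W : Π y : M', TangentSpace (𝓡 n') y) (x : M) :
    VectorField.mpullback (𝓡 n) (𝓡 n') f W x = (diffeoDeriv f x).symm (W (f x)) := by
  rw [VectorField.mpullback_apply]
  have h : mfderiv (𝓡 n) (𝓡 n') f x = diffeoDeriv f x := rfl
  rw [h, ContinuousLinearMap.inverse_equiv]
  rfl

theorem SmoothField.mpullback {W : Π y : M', TangentSpace (𝓡 n') y} (hW : SmoothField W) :
    SmoothField (VectorField.mpullback (𝓡 n) (𝓡 n') f W) :=
  ContMDiff.mpullback_vectorField (n := ∞) hW f.contMDiff (fun x => ⟨diffeoDeriv f x, rfl⟩)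
    (by simp)

theorem pairing_cotangentLift (W : Π y : M', TangentSpace (𝓡 n') y) :
    pairing W ∘ cotangentLift f = pairing (VectorField.mpullback (𝓡 n) (𝓡 n') f W) :=
  funext fun ξ => congrArg ξ.2 (mpullback_eq_diffeoDeriv_symm f W ξ.proj).symm

theorem mdifferentiableAt_cotangentLift (ξ : CotangentBundle n M) :
    MDifferentiableAt (cotangentModel n) (cotangentModel n') (cotangentLift f) ξ :=
  (contMDiff_cotangentLift f).mdifferentiableAt (by simp)

/-- The differential of the lift `f̃`. -/
noncomputable def cotangentLiftDeriv (ξ : CotangentBundle n M) :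
    TangentSpace (cotangentModel n) ξ →L[ℝ] TangentSpace (cotangentModel n') (cotangentLift f ξ) :=
  mfderiv (cotangentModel n) (cotangentModel n') (cotangentLift f) ξ

theorem projDeriv_cotangentLiftDeriv (ξ : CotangentBundle n M)
    (V : TangentSpace (cotangentModel n) ξ) :
    projDeriv (cotangentLift f ξ) (cotangentLiftDeriv f ξ V) =
      diffeoDeriv f ξ.proj (projDeriv ξ V) := by
  have h1 := mfderiv_comp (I' := cotangentModel n') ξ
    (g := (TotalSpace.proj : CotangentBundle n' M' → M'))
    (mdifferentiableAt_proj (E := fun x : M' => CotangentSpace n' x))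
    (mdifferentiableAt_cotangentLift f ξ)
  have h2 := mfderiv_comp (I' := 𝓡 n) ξ (g := f)
    (f := (TotalSpace.proj : CotangentBundle n M → M))
    (mdifferentiableAt_diffeo f ξ.proj)
    (mdifferentiableAt_proj (E := fun x : M => CotangentSpace n x))
  exact DFunLike.congr_fun (h1.symm.trans h2) V

theorem mvfderiv_pairing_cotangentLiftDeriv {W : Π y : M', TangentSpace (𝓡 n') y}
    (hW : SmoothField W) (ξ : CotangentBundle n M) (V : TangentSpace (cotangentModel n) ξ) :
    mvfderiv (cotangentModel n') (pairing W) (cotangentLift f ξ) (cotangentLiftDeriv f ξ V) =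
      mvfderiv (cotangentModel n) (pairing (VectorField.mpullback (𝓡 n) (𝓡 n') f W)) ξ V := by
  have h1 := mfderiv_comp (I' := cotangentModel n') ξ (g := pairing W)
    (pairing_mdiff (hW.mdiff _)) (mdifferentiableAt_cotangentLift f ξ)
  rw [pairing_cotangentLift] at h1
  exact (DFunLike.congr_fun h1 V).symm

theorem mpullback_almostComplexStructure {J : AlmostComplexStructure n M}
    {J' : AlmostComplexStructure n' M'}
    (hf : ∀ (x : M) (X : TangentSpace (𝓡 n) x),
      J'.toFun (f x) (diffeoDeriv f x X) = diffeoDeriv f x (J.toFun x X)) (x : M)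
    (Y : TangentSpace (𝓡 n') (f x)) :
    (diffeoDeriv f x).symm (J'.toFun (f x) Y) = J.toFun x ((diffeoDeriv f x).symm Y) := by
  rw [ContinuousLinearEquiv.symm_apply_eq, ← hf, ContinuousLinearEquiv.apply_symm_apply]

theorem diffeoDeriv_symm_mlieBracket {W W' : Π y : M', TangentSpace (𝓡 n') y}
    (hW : SmoothField W) (hW' : SmoothField W') (x : M) :
    (diffeoDeriv f x).symm (VectorField.mlieBracket (𝓡 n') W W' (f x)) =
      VectorField.mlieBracket (𝓡 n) (VectorField.mpullback (𝓡 n) (𝓡 n') f W)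
        (VectorField.mpullback (𝓡 n) (𝓡 n') f W') x := by
  have : IsManifold (𝓡 n) (minSmoothness ℝ 3) M := IsManifold.of_le (n := ∞) (by simpa using ENat.LEInfty.out)
  have : IsManifold (𝓡 n') (minSmoothness ℝ 3) M' := IsManifold.of_le (n := ∞) (by simpa using ENat.LEInfty.out)
  rw [← mpullback_eq_diffeoDeriv_symm f (VectorField.mlieBracket (𝓡 n') W W')]
  exact VectorField.mpullback_mlieBracket (n := ∞) (hW.mdiff _) (hW'.mdiff _)
    f.contMDiff.contMDiffAt (by simpa using ENat.LEInfty.out)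

/-- The failure of `f̃` to intertwine the generalized horizontal lifts, when `f` is holomorphic. -/
theorem mvfderiv_pairing_cotangentLift_sub [T2Space M] [T2Space M']
    {J : AlmostComplexStructure n M} {J' : AlmostComplexStructure n' M'}
    (cov : AffineConnection n M) (cov' : AffineConnection n' M')
    (hf : ∀ (x : M) (X : TangentSpace (𝓡 n) x),
      J'.toFun (f x) (diffeoDeriv f x X) = diffeoDeriv f x (J.toFun x X))
    (ξ : CotangentBundle n M) (V : TangentSpace (cotangentModel n) ξ)
    {W : Π y : M', TangentSpace (𝓡 n') y} (hW : SmoothField W) :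
    mvfderiv (cotangentModel n') (pairing W) (cotangentLift f ξ)
        (generalizedHorizontalLift J' cov' (cotangentLift f ξ) (cotangentLiftDeriv f ξ V)) -
      mvfderiv (cotangentModel n') (pairing W) (cotangentLift f ξ)
        (cotangentLiftDeriv f ξ (generalizedHorizontalLift J cov ξ V)) =
    ξ.2 ((diffeoDeriv f ξ.proj).symm (tensorS J' cov' (f ξ.proj)
        (diffeoDeriv f ξ.proj (projDeriv ξ V)) (W (f ξ.proj))) -
      tensorS J cov ξ.proj (projDeriv ξ V) ((diffeoDeriv f ξ.proj).symm (W (f ξ.proj)))) := by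
  obtain ⟨X, hX, hXV⟩ := exists_smoothField (x := f ξ.proj) (diffeoDeriv f ξ.proj (projDeriv ξ V))
  have hX' : VectorField.mpullback (𝓡 n) (𝓡 n') f X ξ.proj = projDeriv ξ V := by
    rw [mpullback_eq_diffeoDeriv_symm, hXV, ContinuousLinearEquiv.symm_apply_apply]
  have hJ : ∀ Y : Π y : M', TangentSpace (𝓡 n') y,
      VectorField.mpullback (𝓡 n) (𝓡 n') f (fun y => J'.toFun y (Y y)) =
        fun x => J.toFun x (VectorField.mpullback (𝓡 n) (𝓡 n') f Y x) := fun Y =>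
    funext fun x => by
      rw [mpullback_eq_diffeoDeriv_symm, mpullback_eq_diffeoDeriv_symm,
        mpullback_almostComplexStructure f hf]
  have h1 := mvfderiv_pairing_generalizedHorizontalLift J' cov' hX hW (cotangentLift f ξ)
    (cotangentLiftDeriv f ξ V) ((projDeriv_cotangentLiftDeriv f ξ V).trans hXV.symm)
  have h2 := mvfderiv_pairing_generalizedHorizontalLift J cov (hX.mpullback f) (hW.mpullback f) ξ
    V hX'.symm
  rw [mvfderiv_pairing_cotangentLiftDeriv f (J'.smoothField_apply hW), hJ] at h1
  rw [mvfderiv_pairing_cotangentLiftDeriv f hW, h2, h1, ← hXV, ← hX',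
    mpullback_eq_diffeoDeriv_symm f W]
  have h3 : ∀ Y : TangentSpace (𝓡 n') (f ξ.proj),
      (cotangentLift f ξ).2 Y = ξ.2 ((diffeoDeriv f ξ.proj).symm Y) := fun _ => rfl
  have h4 := diffeoDeriv_symm_mlieBracket f (J'.smoothField_apply hX) hW ξ.proj
  have h5 := diffeoDeriv_symm_mlieBracket f hX hW ξ.proj
  rw [hJ] at h4
  erw [h3]
  rw [add_sub_add_left_eq_sub, ← ContinuousLinearMap.map_sub]
  congr 1
  erw [map_sub, map_add, h4, mpullback_almostComplexStructure f hf, h5]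
  have h6 : ∀ a b c d : TangentSpace (𝓡 n) ξ.proj, a + b - c - (d + b - c) = a - d := by
    intros; abel
  exact h6 _ _ _ _

theorem pushforwardAt_eq_iff (S : Π x : M, TangentSpace (𝓡 n) x → TangentSpace (𝓡 n) x →
    TangentSpace (𝓡 n) x) (S' : Π y : M', TangentSpace (𝓡 n') y → TangentSpace (𝓡 n') y →
    TangentSpace (𝓡 n') y) (x : M) :
    pushforwardAt f S x = S' (f x) ↔ ∀ (X : TangentSpace (𝓡 n) x) (Y : TangentSpace (𝓡 n') (f x)),
      (diffeoDeriv f x).symm (S' (f x) (diffeoDeriv f x X) Y) =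
        S x X ((diffeoDeriv f x).symm Y) := by
  constructor
  · intro h X Y
    rw [← h, pushforwardAt, ContinuousLinearEquiv.symm_apply_apply,
      ContinuousLinearEquiv.symm_apply_apply]
  · intro h
    funext X Y
    rw [pushforwardAt, ← h, ContinuousLinearEquiv.apply_symm_apply,
      ContinuousLinearEquiv.apply_symm_apply]

theorem isHolomorphic_cotangentLift_iff [T2Space M] [T2Space M']
    (J : AlmostComplexStructure n M) (J' : AlmostComplexStructure n' M')
    (cov : AffineConnection n M) (cov' : AffineConnection n' M') :
    IsHolomorphic (cotangentModel n) (cotangentModel n') (generalizedHorizontalLift J cov)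
        (generalizedHorizontalLift J' cov') (cotangentLift f) ↔
      IsHolomorphic (𝓡 n) (𝓡 n') J.toFun J'.toFun f ∧
        ∀ x : M, pushforwardAt f (tensorS J cov) x = tensorS J' cov' (f x) := by
  have hproj : ∀ (ξ : CotangentBundle n M) (V : TangentSpace (cotangentModel n) ξ),
      projDeriv (cotangentLift f ξ) (generalizedHorizontalLift J' cov' (cotangentLift f ξ)
        (cotangentLiftDeriv f ξ V)) =
      J'.toFun (f ξ.proj) (diffeoDeriv f ξ.proj (projDeriv ξ V)) ∧
      projDeriv (cotangentLift f ξ) (cotangentLiftDeriv f ξ (generalizedHorizontalLift J cov ξ V)) =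
        diffeoDeriv f ξ.proj (J.toFun ξ.proj (projDeriv ξ V)) := fun ξ V =>
    ⟨((generalizedHorizontalLift_spec J' cov' (cotangentLift f ξ)).projDeriv_apply _).trans
      (congrArg (J'.toFun (f ξ.proj)) (projDeriv_cotangentLiftDeriv f ξ V)),
    (projDeriv_cotangentLiftDeriv f ξ _).trans (congrArg (diffeoDeriv f ξ.proj)
      ((generalizedHorizontalLift_spec J cov ξ).projDeriv_apply V))⟩
  constructor
  · rintro ⟨-, h⟩
    have h' : ∀ ξ (V : TangentSpace (cotangentModel n) ξ),
        generalizedHorizontalLift J' cov' (cotangentLift f ξ) (cotangentLiftDeriv f ξ V) =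
          cotangentLiftDeriv f ξ (generalizedHorizontalLift J cov ξ V) := fun ξ V =>
      DFunLike.congr_fun (h ξ) V
    have hf : ∀ (x : M) (X : TangentSpace (𝓡 n) x),
        J'.toFun (f x) (diffeoDeriv f x X) = diffeoDeriv f x (J.toFun x X) := by
      intro x X
      obtain ⟨V, rfl⟩ := projDeriv_surjective (⟨x, 0⟩ : CotangentBundle n M) X
      have := hproj ⟨x, 0⟩ V
      rw [h'] at this
      exact this.1.symm.trans this.2
    refine ⟨⟨f.contMDiff, fun x => ContinuousLinearMap.ext (hf x)⟩, fun x => ?_⟩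
    rw [pushforwardAt_eq_iff]
    intro X Y
    obtain ⟨W, hW, rfl⟩ := exists_smoothField Y
    refine sub_eq_zero.1 ?_
    by_contra hne
    obtain ⟨p, hp⟩ : ∃ p : CotangentSpace n x, p _ ≠ 0 :=
      SeparatingDual.exists_ne_zero (R := ℝ) (V := EuclideanSpace ℝ (Fin n)) hne
    obtain ⟨V, rfl⟩ := projDeriv_surjective (⟨x, p⟩ : CotangentBundle n M) X
    have := mvfderiv_pairing_cotangentLift_sub f cov cov' hf ⟨x, p⟩ V hW
    rw [h', sub_self] at this
    exact hp this.symm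
  · rintro ⟨⟨-, h⟩, hS⟩
    have hf : ∀ (x : M) (X : TangentSpace (𝓡 n) x),
        J'.toFun (f x) (diffeoDeriv f x X) = diffeoDeriv f x (J.toFun x X) := fun x X =>
      DFunLike.congr_fun (h x) X
    refine ⟨contMDiff_cotangentLift f, fun ξ => ContinuousLinearMap.ext fun V => ?_⟩
    refine eq_of_mvfderiv_pairing cov' (cotangentLift f ξ)
      ((hproj ξ V).1.trans ((hf _ _).trans (hproj ξ V).2.symm)) fun W hW => ?_
    have := mvfderiv_pairing_cotangentLift_sub f cov cov' hf ξ V hW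
    rw [(pushforwardAt_eq_iff f _ _ _).1 (hS ξ.proj), sub_self, map_zero] at this
    exact sub_eq_zero.1 this

end Diffeo

end CotangentLift

theorem theorem2
    {n : ℕ} {M : Type*} [TopologicalSpace M] [T2Space M]
    [ChartedSpace (EuclideanSpace ℝ (Fin n)) M] [IsManifold (𝓡 n) ∞ M]
    (J : CotangentLift.AlmostComplexStructure n M) (cov : CotangentLift.AffineConnection n M)
    {n₁ : ℕ} {M₁ : Type*} [TopologicalSpace M₁] [T2Space M₁]
    [ChartedSpace (EuclideanSpace ℝ (Fin n₁)) M₁] [IsManifold (𝓡 n₁) ∞ M₁]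
    (J₁ : CotangentLift.AlmostComplexStructure n₁ M₁)
    (cov₁ : CotangentLift.AffineConnection n₁ M₁)
    {n₂ : ℕ} {M₂ : Type*} [TopologicalSpace M₂] [T2Space M₂]
    [ChartedSpace (EuclideanSpace ℝ (Fin n₂)) M₂] [IsManifold (𝓡 n₂) ∞ M₂]
    (J₂ : CotangentLift.AlmostComplexStructure n₂ M₂)
    (cov₂ : CotangentLift.AffineConnection n₂ M₂)
    (f : M₁ ≃ₘ^∞⟮𝓡 n₁, 𝓡 n₂⟯ M₂) :
    CotangentLift.IsHolomorphic (CotangentLift.cotangentModel n) (𝓡 n)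
        (CotangentLift.generalizedHorizontalLift J cov) J.toFun
        (fun ξ : CotangentLift.CotangentBundle n M => ξ.proj) ∧
    CotangentLift.IsHolomorphic (𝓡 n) (CotangentLift.cotangentModel n)
        J.toFun (CotangentLift.generalizedHorizontalLift J cov)
        (fun x : M => (⟨x, 0⟩ : CotangentLift.CotangentBundle n M)) ∧
    (CotangentLift.IsHolomorphic (CotangentLift.cotangentModel n₁)
        (CotangentLift.cotangentModel n₂)
        (CotangentLift.generalizedHorizontalLift J₁ cov₁)
        (CotangentLift.generalizedHorizontalLift J₂ cov₂) (CotangentLift.cotangentLift f) ↔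
      CotangentLift.IsHolomorphic (𝓡 n₁) (𝓡 n₂) J₁.toFun J₂.toFun f ∧
        ∀ x : M₁, CotangentLift.pushforwardAt f (CotangentLift.tensorS J₁ cov₁) x =
          CotangentLift.tensorS J₂ cov₂ (f x)) :=
  ⟨CotangentLift.isHolomorphic_proj J cov, CotangentLift.isHolomorphic_zeroSection J cov,
    CotangentLift.isHolomorphic_cotangentLift_iff f J₁ J₂ cov₁ cov₂⟩
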